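/- Fix real numbers $\ell\ge 1$ and $b>2(e\ell)^{1/\ell}$. For $c\in\mathbb{R}$ let $f_c:\mathbb{R}\to\mathbb{R}$ be given by $f_c(x)=b\,e^{-1/|x|^{\ell}}+c$ for $x\neq 0$ and $f_c(0)=c$. Each $f_c$ is unimodal: continuous, strictly decreasing on $(-\infty,0]$ and strictly increasing on $[0,\infty)$. There is exactly one $\beta\in(0,\ell^{1/\ell})$ with $f_{-\beta}(\beta)=\beta$ (the Chebyshev parameter), and for this $\beta$ the following hold. (1) The kneading sequence $\mathcal{K}(f_c)$ is monotone increasing in $c\in[-\beta,\infty)$: if $-\beta\le c_1\le c_2$, then $\mathcal{K}(f_{c_1})\prec\mathcal{K}(f_{c_2})$ or $\mathcal{K}(f_{c_1})=\mathcal{K}(f_{c_2})$. Here $\mathcal{K}(f)=i_1i_2\cdots$, where $i_k\in\{-1,0,1\}$ is the sign of $f^k(0)$ for $k\ge1$, and $i_1i_2\cdots\prec j_1j_2\cdots$ means that there is some $n\ge 1$ such that $i_k=j_k$ for all $1\le k<n$ and $\prod_{k=1}^n i_k<\prod_{k=1}^n j_k$. (2) Positive transversality: if $c_*\ge-\beta$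 and $0$ is a periodic point of $f_{c_*}$ of (least) period $q\ge1$, then $c\mapsto f_c^q(0)$ is differentiable at $c_*$, the derivatives $Df_{c_*}^n(c_*)$ exist and are nonzero for $0\le n<q$, and $$\frac{\frac{d}{dc}f_c^q(0)\big|_{c=c_*}}{Df_{c_*}^{q-1}(c_*)}=\sum_{n=0}^{q-1}\frac{1}{Df_{c_*}^n(c_*)}>0.$$ -/

import Mathlib

open scoped BigOperators

/-- The class of unimodal maps of the real line with turning point `0`: continuous, strictly
decreasing on `(-∞, 0]` and strictly increasing on `[0, ∞)`. -/
def IsUnimodal (f : ℝ → ℝ) : Prop :=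
  Continuous f ∧ StrictAntiOn f (Set.Iic 0) ∧ StrictMonoOn f (Set.Ici 0)

/-- The Milnor-Thurston kneading sequence `i₁ i₂ ⋯` of `f`: `i_k` is the sign
(`1`, `0` or `-1`) of `f^k(0)`, for `k ≥ 1`. -/
noncomputable def kneadingSeq (f : ℝ → ℝ) : ℕ+ → SignType :=
  fun k => SignType.sign (f^[(k : ℕ)] 0)

/-- The strict order `i ≺ j` on words: for some `n ≥ 1`, `i_k = j_k` for `1 ≤ k < n`, and
`i₁ ⋯ i_n < j₁ ⋯ j_n` (products in `{-1, 0, 1}`, with `-1 < 0 < 1`). -/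
def KneadingLT (i j : ℕ+ → SignType) : Prop :=
  ∃ n : ℕ+, (∀ k : ℕ+, k < n → i k = j k) ∧
    ∏ k ∈ Finset.Icc 1 n, i k < ∏ k ∈ Finset.Icc 1 n, j k

/-- The weak order `i ≼ j`: `i ≺ j` or `i = j`. -/
def KneadingLE (i j : ℕ+ → SignType) : Prop :=
  KneadingLT i j ∨ i = j

/-- The family `f_c(x) = b e^{-1/|x|^ℓ} + c`, with `f_c(0) = c`. -/
noncomputable def flatMap (ℓ b c : ℝ) (x : ℝ) : ℝ :=
  if x = 0 then c else b * Real.exp (-1 / |x| ^ ℓ) + c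

/-- `β` is the Chebyshev parameter: `β ∈ (0, ℓ^{1/ℓ})` and `f_{-β}(β) = β`. -/
def IsChebyshevParameter (ℓ b β : ℝ) : Prop :=
  β ∈ Set.Ioo 0 (ℓ ^ (1 / ℓ)) ∧ flatMap ℓ b (-β) β = β

/-- The positive transversality condition at a parameter `c` for which `0` has period `q`
under `f c`:
`(d/dt f_t^q(0) at t = c) / D f_c^{q-1}(c) = ∑_{n=0}^{q-1} 1 / D f_c^n(c) > 0`,
where all the derivatives exist and all the denominators are nonzero. -/
def PositivelyTransversal (f : ℝ → ℝ → ℝ) (c : ℝ) (q : ℕ) : Prop :=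
  DifferentiableAt ℝ (fun t => (f t)^[q] 0) c ∧
  (∀ n < q, DifferentiableAt ℝ ((f c)^[n]) c ∧ deriv ((f c)^[n]) c ≠ 0) ∧
  deriv (fun t => (f t)^[q] 0) c / deriv ((f c)^[q - 1]) c =
    ∑ n ∈ Finset.range q, 1 / deriv ((f c)^[n]) c ∧
  0 < ∑ n ∈ Finset.range q, 1 / deriv ((f c)^[n]) c

/-! Write `f` for `flatMap ℓ b c` with `0` periodic of period `q`. Transversality comes from
rigidity of holomorphic motions of the critical orbit `P`. Suppose `v` on `P` has `v 0 = 0` and `m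
f'(x) v(x) = v(f x) - v(f 0)` off `0`, with `m ≥ 1`. A motion of `P` in the disc of radius `β` with
initial velocity `t v` lifts through `f` to one with velocity `m t v`. The Chebyshev relation `b exp
(-1 / β ^ ℓ) = 2 β` and `ℓ ≥ 1` put the lift inside the two discs with diameters `(0, ±β)`, which
touch the circle of radius `β` only at `±β`. That leaves room to compose with `z ↦ z + s p(z)`,
where `p` interpolates `v` and vanishes doubly at `±β`; taking `s` proportional to the time variable
adds a fixed amount to `t`. Iteration makes `t` unbounded, while the Schwarz lemma bounds `t v`;
hence `v = 0` (`IsMotion.lift`, `flat_rigidity`).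

Put `D(ρ) = ∑ ρ^k / Df^k(c)`, summed over `k < q`. A root `ρ ∈ (0, 1]` would give a nonzero such `v`
with `m = 1 / ρ`. As `D(0) = 1`, it follows that `D(1) > 0`, which is positive transversality.

The kneading order compares partial products lexicographically. Finite words of partial products are
locally constant in `c` unless `0` is periodic with a short period; there transversality makes the
first vanishing product pass from `-1` to `1`. Local monotonicity at every parameter gives global
monotonicity. -/

/-! ### Inverse branches along holomorphic discs -/

/-- A nonvanishing holomorphic function on the unit disc has a holomorphic logarithm with a
prescribed value at the centre. -/
theorem exists_holomorphic_log {g : ℂ → ℂ} (hg : DifferentiableOn ℂ g (Metric.ball 0 1))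
    (hne : ∀ z ∈ Metric.ball (0 : ℂ) 1, g z ≠ 0) {y : ℂ} (hy : Complex.exp y = g 0) :
    ∃ L : ℂ → ℂ, DifferentiableOn ℂ L (Metric.ball 0 1) ∧ L 0 = y ∧
      ∀ z ∈ Metric.ball (0 : ℂ) 1, Complex.exp (L z) = g z := by
  have ho : IsOpen (Metric.ball (0 : ℂ) 1) := Metric.isOpen_ball
  have h0 : (0 : ℂ) ∈ Metric.ball (0 : ℂ) 1 := Metric.mem_ball_self one_pos
  have hd : DifferentiableOn ℂ (fun z => deriv g z / g z) (Metric.ball 0 1) :=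
    (hg.deriv ho).div hg hne
  obtain ⟨F, hF0, hF⟩ := hd.isExactOn_ball.with_val_at 0 y
  have key : ∀ z ∈ Metric.ball (0 : ℂ) 1, HasDerivAt (fun z => g z * Complex.exp (-F z)) 0 z := by
    intro z hz
    have h1 := (hg.differentiableAt (ho.mem_nhds hz)).hasDerivAt
    have h2 := (hF z hz).neg.cexp
    refine (h1.mul h2).congr_deriv ?_
    have := hne z hz
    simp only [Pi.neg_apply]
    field_simp
    ring
  have hconst : ∀ z ∈ Metric.ball (0 : ℂ) 1,
      g z * Complex.exp (-F z) = g 0 * Complex.exp (-F 0) := by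
    intro z hz
    exact ho.is_const_of_deriv_eq_zero (convex_ball _ _).isPreconnected
      (fun w hw => (key w hw).differentiableAt.differentiableWithinAt)
      (fun w hw => (key w hw).deriv) hz h0
  refine ⟨F, fun z hz => (hF z hz).differentiableAt.differentiableWithinAt, hF0, fun z hz => ?_⟩
  have h1 := hconst z hz
  rw [hF0, ← hy, ← Complex.exp_add, add_neg_cancel, Complex.exp_zero, Complex.exp_neg] at h1
  have := Complex.exp_ne_zero (F z)
  field_simp at h1
  exact h1.symm

/-- Both sides are separated by `s cos θ + (1 - s)`: weighted AM-GM on the left, concavity of the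
cosine on the right. -/
theorem Real.cos_rpow_le_cos_mul {s θ : ℝ} (hs0 : 0 ≤ s) (hs1 : s ≤ 1)
    (hθ : θ ∈ Set.Icc (-(Real.pi / 2)) (Real.pi / 2)) : Real.cos θ ^ s ≤ Real.cos (s * θ) := by
  have hc : 0 ≤ Real.cos θ := Real.cos_nonneg_of_mem_Icc hθ
  have h1 := Real.geom_mean_le_arith_mean2_weighted hs0 (sub_nonneg.2 hs1) hc zero_le_one
    (by ring)
  have h2 := strictConcaveOn_cos_Icc.concaveOn.2 hθ
    (⟨by linarith [Real.pi_pos], by linarith [Real.pi_pos]⟩ :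
      (0 : ℝ) ∈ Set.Icc (-(Real.pi / 2)) (Real.pi / 2)) hs0 (sub_nonneg.2 hs1) (by ring)
  simp at h1 h2
  linarith

/-- In polar form this is the preceding cosine inequality. It says that the power `s = 1 / ℓ ≤ 1`
maps the half-plane `Re > a` into `Re > a ^ s`, for `a > 0`. -/
theorem Complex.rpow_re_le_re_cpow {w : ℂ} (hw : 0 < w.re) {s : ℝ} (hs0 : 0 ≤ s) (hs1 : s ≤ 1) :
    w.re ^ s ≤ (w ^ (s : ℂ)).re := by
  have h1 : |Complex.arg w| < Real.pi / 2 := Complex.abs_arg_lt_pi_div_two_iff.2 (Or.inl hw)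
  rw [Complex.cpow_ofReal_re]
  have h2 : w.re = ‖w‖ * Real.cos (Complex.arg w) := (Complex.norm_mul_cos_arg w).symm
  have h3 : Complex.arg w ∈ Set.Icc (-(Real.pi / 2)) (Real.pi / 2) := abs_le.1 h1.le
  rw [h2, Real.mul_rpow (norm_nonneg _) (Real.cos_nonneg_of_mem_Icc h3), mul_comm (Complex.arg w)]
  gcongr
  exact Real.cos_rpow_le_cos_mul hs0 hs1 h3

/-- Branches of the inverse of `z ↦ b exp (-1 / z ^ ℓ)` along a holomorphic disc avoiding `0`. The
lifted disc stays in the round disc with diameter `(0, β)` if `b exp (-1 / β ^ ℓ) = 2 β`. -/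
theorem exists_flat_lift {ℓ b β x : ℝ} (hℓ : 1 ≤ ℓ) (hb : 0 < b) (hβ : 0 < β) (hx : 0 < x)
    (hbβ : b * Real.exp (-1 / β ^ ℓ) = 2 * β) {g : ℂ → ℂ}
    (hg : DifferentiableOn ℂ g (Metric.ball 0 1))
    (hne : ∀ z ∈ Metric.ball (0 : ℂ) 1, g z ≠ 0) (hlt : ∀ z ∈ Metric.ball (0 : ℂ) 1, ‖g z‖ < 2 * β)
    (hg0 : g 0 = (b * Real.exp (-1 / x ^ ℓ) : ℝ)) :
    ∃ u : ℂ → ℂ, DifferentiableOn ℂ u (Metric.ball 0 1) ∧ u 0 = x ∧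
      ((b * Real.exp (-1 / x ^ ℓ) * (ℓ * x ^ (-ℓ - 1)) : ℝ) : ℂ) * deriv u 0 = deriv g 0 ∧
      (∀ z ∈ Metric.ball (0 : ℂ) 1, u z ∈ Metric.ball ((β / 2 : ℝ) : ℂ) (β / 2)) ∧
      ∀ z ∈ Metric.ball (0 : ℂ) 1, g z = b * Complex.exp (-(u z) ^ (-ℓ : ℂ)) := by
  have ho : IsOpen (Metric.ball (0 : ℂ) 1) := Metric.isOpen_ball
  have h0 : (0 : ℂ) ∈ Metric.ball (0 : ℂ) 1 := Metric.mem_ball_self one_pos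
  have hℓ0 : 0 < ℓ := by linarith
  have hbC : (b : ℂ) ≠ 0 := by exact_mod_cast hb.ne'
  have hy : Complex.exp ((-1 / x ^ ℓ : ℝ) : ℂ) = g 0 / b := by
    rw [hg0]
    push_cast
    field_simp
  obtain ⟨L, hL, hL0, hLg⟩ := exists_holomorphic_log (g := fun z => g z / b) (hg.div_const _)
    (fun z hz => div_ne_zero (hne z hz) hbC) hy
  have hxl : 0 < x ^ ℓ := Real.rpow_pos_of_pos hx _
  have hβl : 0 < β ^ ℓ := Real.rpow_pos_of_pos hβ _
  -- The bound `‖g‖ < 2 β = b exp (-1 / β ^ ℓ)` confines the logarithm of `g / b` to a half-plane.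
  have hre : ∀ z ∈ Metric.ball (0 : ℂ) 1, 1 / β ^ ℓ < (-L z).re := by
    intro z hz
    have h1 : Real.exp (L z).re < Real.exp (-1 / β ^ ℓ) := by
      rw [← Complex.norm_exp, hLg z hz, norm_div, Complex.norm_real, Real.norm_of_nonneg hb.le,
        div_lt_iff₀ hb, mul_comm, hbβ]
      exact hlt z hz
    have h2 := Real.exp_lt_exp.1 h1
    rw [Complex.neg_re]
    rw [neg_div] at h2
    linarith
  have hre0 : ∀ z ∈ Metric.ball (0 : ℂ) 1, 0 < (-L z).re := fun z hz =>
    lt_trans (by positivity) (hre z hz)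
  have hw0 : -L 0 = ((x ^ ℓ)⁻¹ : ℝ) := by rw [hL0, ← Complex.ofReal_neg]; congr 1; field_simp
  have hs : 0 < 1 / ℓ := by positivity
  have hs1 : 1 / ℓ ≤ 1 := by rw [div_le_one hℓ0]; exact hℓ
  have hu : ∀ z ∈ Metric.ball (0 : ℂ) 1, HasDerivAt (fun z => (-L z) ^ (-(1 / ℓ : ℝ) : ℂ))
      ((-(1 / ℓ : ℝ) : ℂ) * (-L z) ^ ((-(1 / ℓ : ℝ) : ℂ) - 1) * -deriv L z) z := by
    intro z hz
    have h1 := (hL.differentiableAt (ho.mem_nhds hz)).hasDerivAt.neg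
    exact h1.cpow_const (Or.inl (hre0 z hz))
  have hu0 : (-L 0) ^ (-(1 / ℓ : ℝ) : ℂ) = x := by
    rw [hw0, ← Complex.ofReal_neg, ← Complex.ofReal_cpow (by positivity), ← Real.rpow_neg hx.le,
      ← Real.rpow_mul hx.le]
    rw [show -ℓ * -(1 / ℓ) = 1 by field_simp, Real.rpow_one]
  refine ⟨fun z => (-L z) ^ (-(1 / ℓ : ℝ) : ℂ), fun z hz =>
    (hu z hz).differentiableAt.differentiableWithinAt, hu0, ?_, ?_, ?_⟩
  · rw [(hu 0 h0).deriv]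
    have h1 : HasDerivAt (fun z => (b : ℂ) * Complex.exp (L z))
        (b * (Complex.exp (L 0) * deriv L 0)) 0 :=
      ((hL.differentiableAt (ho.mem_nhds h0)).hasDerivAt.cexp).const_mul _
    have h2 : g =ᶠ[nhds 0] fun z => (b : ℂ) * Complex.exp (L z) := by
      filter_upwards [ho.mem_nhds h0] with z hz
      rw [hLg z hz]; field_simp
    rw [h2.deriv_eq, h1.deriv, Complex.cpow_sub _ _ (by
      rw [hw0]; exact_mod_cast (by positivity : (x ^ ℓ)⁻¹ ≠ 0)), hu0, hw0, hL0, Complex.cpow_one,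
      show -ℓ - 1 = -(ℓ + 1) by ring, Real.rpow_neg hx.le, Real.rpow_add_one hx.ne']
    have hxC : (x : ℂ) ≠ 0 := by exact_mod_cast hx.ne'
    have hℓC : (ℓ : ℂ) ≠ 0 := by exact_mod_cast hℓ0.ne'
    have hxlC : ((x ^ ℓ : ℝ) : ℂ) ≠ 0 := by exact_mod_cast hxl.ne'
    push_cast
    field_simp
  · intro z hz
    have hwne : -L z ≠ 0 := by
      intro h; have := hre0 z hz; rw [h] at this; simp at this
    have h1 := Complex.rpow_re_le_re_cpow (hre0 z hz) hs.le hs1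
    have h2 : 1 / β < ((-L z) ^ ((1 / ℓ : ℝ) : ℂ)).re := by
      refine lt_of_lt_of_le ?_ h1
      calc 1 / β = (1 / β ^ ℓ) ^ (1 / ℓ) := by
            rw [Real.div_rpow zero_le_one hβl.le, Real.one_rpow, ← Real.rpow_mul hβ.le,
              mul_one_div_cancel hℓ0.ne', Real.rpow_one]
        _ < _ := Real.rpow_lt_rpow (by positivity) (hre z hz) hs
    simp only [Metric.mem_ball, dist_eq_norm]
    rw [Complex.cpow_neg]
    set y := (-L z) ^ ((1 / ℓ : ℝ) : ℂ) with hy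
    have hy0 : y ≠ 0 := by
      intro h; rw [h] at h2; simp at h2; linarith [inv_pos.2 hβ]
    have hny : 0 < ‖y‖ := norm_pos_iff.2 hy0
    -- Inversion takes the half-plane `Re y > 1 / β` to the disc with diameter `(0, β)`.
    have h3 : y⁻¹ - ((β / 2 : ℝ) : ℂ) = (1 - (β / 2 : ℝ) * y) / y := by field_simp
    rw [h3, norm_div, div_lt_iff₀ hny]
    refine lt_of_pow_lt_pow_left₀ 2 (by positivity) ?_
    rw [mul_pow, Complex.sq_norm, Complex.sq_norm, Complex.normSq_apply, Complex.normSq_apply]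
    rw [div_lt_iff₀ hβ] at h2
    simp
    nlinarith
  · intro z hz
    have hwne : -L z ≠ 0 := by
      intro h; have := hre0 z hz; rw [h] at this; simp at this
    have ha : |Complex.arg (-L z)| < Real.pi / 2 :=
      Complex.abs_arg_lt_pi_div_two_iff.2 (Or.inl (hre0 z hz))
    -- The principal powers compose because `|arg| < π / 2` and `1 / ℓ ≤ 1` keep the intermediate
    -- argument within `(-π, π)`.
    have h1 : ((-L z) ^ (-(1 / ℓ : ℝ) : ℂ)) ^ (-ℓ : ℂ) = -L z := by
      have him : (Complex.log (-L z) * (-(1 / ℓ : ℝ) : ℂ)).im = - (1 / ℓ) * Complex.arg (-L z) := by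
        rw [← Complex.ofReal_neg, Complex.im_mul_ofReal, Complex.log_im]; ring
      have hb2 : |-(1 / ℓ) * Complex.arg (-L z)| < Real.pi := by
        rw [abs_mul, abs_neg, abs_of_pos hs]
        have := abs_nonneg (Complex.arg (-L z))
        nlinarith [Real.pi_pos]
      rw [← Complex.cpow_mul _ (by rw [him]; exact (abs_lt.1 hb2).1)
        (by rw [him]; exact (abs_lt.1 hb2).2.le)]
      have hℓC : (ℓ : ℂ) ≠ 0 := by exact_mod_cast hℓ0.ne'
      rw [show (-((1 / ℓ : ℝ) : ℂ)) * (-ℓ : ℂ) = 1 by push_cast; field_simp, Complex.cpow_one]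
    simp only
    rw [h1, neg_neg, hLg z hz]
    field_simp

/-! ### Perturbations of the disc tangent to the identity at `±β` -/

open Polynomial in
/-- Interpolation by polynomials vanishing to second order at `±β`. -/
theorem exists_interpolating_polynomial (P : Finset ℝ) {β : ℝ} (hP : ∀ x ∈ P, |x| < β)
    (v : ℝ → ℝ) : ∃ p r : ℂ[X], (∀ x ∈ P, p.eval (x : ℂ) = v x) ∧
      ∀ z : ℂ, p.eval z = (z ^ 2 - β ^ 2) ^ 2 * r.eval z := by
  let r : ℂ[X] := Lagrange.interpolate P (fun x : ℝ => (x : ℂ))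
    (fun x => ((v x / (x ^ 2 - β ^ 2) ^ 2 : ℝ) : ℂ))
  refine ⟨(X ^ 2 - C ((β : ℂ) ^ 2)) ^ 2 * r, r, fun x hx => ?_, fun z => by simp⟩
  have h1 : r.eval (x : ℂ) = _ :=
    Lagrange.eval_interpolate_at_node _ (Complex.ofReal_injective.injOn) hx
  have h2 : x ^ 2 - β ^ 2 ≠ 0 := by
    have := sq_lt_sq' (abs_lt.1 (hP x hx)).1 (abs_lt.1 (hP x hx)).2
    linarith
  have h3 : ((x : ℂ) ^ 2 - (β : ℂ) ^ 2) ≠ 0 := by exact_mod_cast h2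
  rw [eval_mul, h1]
  simp
  field_simp

open Polynomial in
theorem Polynomial.exists_lipschitz_closedBall (p : ℂ[X]) (R : ℝ) :
    ∃ K : ℝ, 0 ≤ K ∧ ∀ z ∈ Metric.closedBall (0 : ℂ) R, ∀ w ∈ Metric.closedBall (0 : ℂ) R,
      ‖p.eval z - p.eval w‖ ≤ K * ‖z - w‖ := by
  obtain ⟨K, hK⟩ := (isCompact_closedBall (0 : ℂ) R).exists_bound_of_continuousOn
    (f := fun z => p.derivative.eval z) p.derivative.continuous.continuousOn
  refine ⟨max K 0, le_max_right _ _, fun z hz w hw => ?_⟩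
  refine (convex_closedBall (0 : ℂ) R).norm_image_sub_le_of_norm_deriv_le
    (fun x _ => p.differentiable x) (fun x hx => ?_) hw hz
  rw [p.deriv]
  exact (hK x hx).trans (le_max_left _ _)

open Polynomial in
/-- If `p` vanishes to second order at `±β`, then for small `s` the map `z ↦ z + s p(z)` is
injective on the disc of radius `β` and maps the discs with diameters `(0, ±β)` into it. -/
theorem exists_univalent_perturbation {β : ℝ} (hβ : 0 < β) {p r : ℂ[X]}
    (hp : ∀ z : ℂ, p.eval z = (z ^ 2 - β ^ 2) ^ 2 * r.eval z) :
    ∃ ε : ℝ, 0 < ε ∧ ∀ s : ℂ, ‖s‖ < ε →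
      Set.InjOn (fun z : ℂ => z + s * p.eval z) (Metric.ball 0 β) ∧
      ∀ σ : ℂ, (σ = 1 ∨ σ = -1) → ∀ u ∈ Metric.ball ((β / 2 : ℝ) : ℂ) (β / 2),
        ‖σ * u + s * p.eval (σ * u)‖ < β := by
  obtain ⟨K, hK0, hK⟩ := p.exists_lipschitz_closedBall β
  obtain ⟨C, hC⟩ := (isCompact_closedBall (0 : ℂ) β).exists_bound_of_continuousOn
    (f := fun z => r.eval z) r.continuous.continuousOn
  have hC0 : 0 ≤ C := (norm_nonneg _).trans (hC 0 (Metric.mem_closedBall_self hβ.le))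
  -- The first bound makes `s p` a strict contraction, hence the map injective; the second controls
  -- the image of the small discs.
  refine ⟨min (1 / (K + 1)) (1 / (8 * β ^ 3 * (C + 1))), by positivity, fun s hs => ⟨?_, ?_⟩⟩
  · intro z hz w hw h
    have h1 : z - w = s * (p.eval w - p.eval z) := by
      simp only at h
      linear_combination h
    have h2 := hK w (Metric.ball_subset_closedBall hw) z (Metric.ball_subset_closedBall hz)
    have h3 : ‖s‖ * (K + 1) < 1 := by
      have := lt_of_lt_of_le hs (min_le_left _ _)
      rwa [lt_div_iff₀ (by positivity)] at this
    have h4 : ‖z - w‖ ≤ ‖s‖ * (K * ‖z - w‖) := by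
      conv_lhs => rw [h1]
      rw [norm_mul, norm_sub_rev z w]
      gcongr
    by_contra hne
    have h5 : 0 < ‖z - w‖ := norm_pos_iff.2 (sub_ne_zero.2 hne)
    nlinarith [norm_nonneg s]
  · intro σ hσ u hu
    have hσ2 : σ ^ 2 = 1 := by rcases hσ with rfl | rfl <;> norm_num
    have hσn : ‖σ‖ = 1 := by rcases hσ with rfl | rfl <;> simp
    -- Thales: inside the disc with diameter `(0, β)` the angle subtended by the diameter is obtuse.
    -- Hence `‖u - β‖ ^ 2` is at most linear in the gap `β - ‖u‖`, and the double zero of `p` keeps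
    -- the displacement below that gap.
    have h1 : ‖u‖ ^ 2 < β ^ 2 - ‖u - β‖ ^ 2 := by
      rw [Metric.mem_ball, dist_eq_norm] at hu
      have h := pow_lt_pow_left₀ hu (norm_nonneg _) two_ne_zero
      rw [Complex.sq_norm, Complex.normSq_apply] at h
      rw [Complex.sq_norm, Complex.sq_norm, Complex.normSq_apply, Complex.normSq_apply]
      simp at h ⊢
      nlinarith
    have hd0 := norm_nonneg (u - β)
    have hu0 := norm_nonneg u
    have h2 : ‖u‖ < β := lt_of_pow_lt_pow_left₀ 2 hβ.le (by nlinarith)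
    have h3 : ‖u - β‖ ^ 2 ≤ 2 * β * (β - ‖u‖) := by nlinarith
    have h4 : ‖p.eval (σ * u)‖ ≤ ‖u - β‖ ^ 2 * (2 * β) ^ 2 * C := by
      rw [hp, mul_pow, hσ2, one_mul, show u ^ 2 - (β : ℂ) ^ 2 = (u - β) * (u + β) by ring, norm_mul,
        mul_pow, norm_mul, norm_pow, norm_pow]
      have h5 : ‖u + β‖ ≤ 2 * β := by
        refine (norm_add_le _ _).trans ?_
        rw [Complex.norm_real, Real.norm_of_nonneg hβ.le]
        linarith
      gcongr
      refine hC _ ?_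
      rw [mem_closedBall_zero_iff, norm_mul, hσn, one_mul]
      exact h2.le
    have h6 : ‖s‖ * (8 * β ^ 3 * (C + 1)) < 1 := by
      have := lt_of_lt_of_le hs (min_le_right _ _)
      rwa [lt_div_iff₀ (by positivity)] at this
    have h7 : ‖s * p.eval (σ * u)‖ < β - ‖u‖ := by
      rw [norm_mul]
      have h9 : 0 < β - ‖u‖ := by linarith
      calc ‖s‖ * ‖p.eval (σ * u)‖ ≤ ‖s‖ * ((2 * β * (β - ‖u‖)) * (2 * β) ^ 2 * (C + 1)) := by
            gcongr
            refine h4.trans ?_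
            gcongr
            linarith
        _ = (‖s‖ * (8 * β ^ 3 * (C + 1))) * (β - ‖u‖) := by ring
        _ < 1 * (β - ‖u‖) := by gcongr
        _ = _ := one_mul _
    calc _ ≤ ‖σ * u‖ + ‖s * p.eval (σ * u)‖ := norm_add_le _ _
      _ < ‖u‖ + (β - ‖u‖) := by rw [norm_mul, hσn, one_mul]; gcongr
      _ = β := by ring

/-! ### Holomorphic motions and infinitesimal rigidity -/

/-- The derivative of `flatMap ℓ b c` at a nonzero point. -/
noncomputable def flatDeriv (ℓ b x : ℝ) : ℝ :=
  SignType.sign x * (b * Real.exp (-1 / |x| ^ ℓ) * (ℓ * |x| ^ (-ℓ - 1)))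

/-- A holomorphic motion over the unit disc of a set `P` of real numbers, inside the disc of
radius `β`, fixing `0`, with initial velocity `t v`. -/
structure IsMotion (P : Finset ℝ) (β : ℝ) (v : ℝ → ℝ) (t : ℝ) (h : ℝ → ℂ → ℂ) : Prop where
  differentiableOn : ∀ x ∈ P, DifferentiableOn ℂ (h x) (Metric.ball 0 1)
  base : ∀ x ∈ P, h x 0 = x
  deriv_eq : ∀ x ∈ P, deriv (h x) 0 = (t * v x : ℝ)
  norm_lt : ∀ x ∈ P, ∀ z ∈ Metric.ball (0 : ℂ) 1, ‖h x z‖ < β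
  zero : ∀ z ∈ Metric.ball (0 : ℂ) 1, h 0 z = 0
  injOn : ∀ z ∈ Metric.ball (0 : ℂ) 1, Set.InjOn (fun x => h x z) P

theorem isMotion_const {P : Finset ℝ} {β : ℝ} (hP : ∀ x ∈ P, |x| < β) (v : ℝ → ℝ) :
    IsMotion P β v 0 (fun x _ => (x : ℂ)) where
  differentiableOn _ _ := differentiableOn_const _
  base _ _ := rfl
  deriv_eq _ _ := by simp
  norm_lt x hx _ _ := by simpa using hP x hx
  zero _ _ := by simp
  injOn _ _ := Complex.ofReal_injective.injOn

/-- Schwarz lemma: each trajectory maps the unit disc into the disc of radius `2 β` about its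
starting point. -/
theorem IsMotion.abs_mul_le {P : Finset ℝ} {β : ℝ} {v : ℝ → ℝ} {t : ℝ} {h : ℝ → ℂ → ℂ}
    (H : IsMotion P β v t h) {x : ℝ} (hx : x ∈ P) : |t * v x| ≤ 2 * β := by
  have h1 := Complex.norm_deriv_le_div_of_mapsTo_ball (R₁ := 1) (R₂ := 2 * β)
    (H.differentiableOn x hx) (fun z hz => by
      rw [Metric.mem_closedBall, dist_eq_norm]
      refine (norm_sub_le _ _).trans ?_
      have h2 := H.norm_lt x hx z hz
      have h3 := H.norm_lt x hx 0 (Metric.mem_ball_self one_pos)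
      linarith) one_pos
  rwa [H.deriv_eq x hx, Complex.norm_real, Real.norm_eq_abs, div_one] at h1

theorem flatMap_of_ne {ℓ b c x : ℝ} (hx : x ≠ 0) :
    flatMap ℓ b c x = b * Real.exp (-1 / |x| ^ ℓ) + c := by simp [flatMap, hx]

theorem flatMap_zero {ℓ b c : ℝ} : flatMap ℓ b c 0 = c := by simp [flatMap]

/-- Lifting a holomorphic motion through `flatMap` and speeding it up. -/
theorem IsMotion.lift {ℓ b β c : ℝ} (hℓ : 1 ≤ ℓ) (hb : 0 < b) (hβ : 0 < β)
    (hbβ : b * Real.exp (-1 / β ^ ℓ) = 2 * β) {P : Finset ℝ} (h0P : 0 ∈ P)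
    (hfP : ∀ x ∈ P, flatMap ℓ b c x ∈ P) {v : ℝ → ℝ} (hv0 : v 0 = 0) {m : ℝ}
    (hv : ∀ x ∈ P, x ≠ 0 → m * (flatDeriv ℓ b x * v x) =
      v (flatMap ℓ b c x) - v (flatMap ℓ b c 0))
    {p : Polynomial ℂ} (hpv : ∀ x ∈ P, p.eval (x : ℂ) = v x) {ε : ℝ}
    (hinj : ∀ s : ℂ, ‖s‖ < 2 * ε →
      Set.InjOn (fun z : ℂ => z + s * p.eval z) (Metric.ball 0 β) ∧
      ∀ σ : ℂ, (σ = 1 ∨ σ = -1) → ∀ u ∈ Metric.ball ((β / 2 : ℝ) : ℂ) (β / 2),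
        ‖σ * u + s * p.eval (σ * u)‖ < β) (hε : 0 < ε)
    {t : ℝ} {h : ℝ → ℂ → ℂ} (H : IsMotion P β v t h) :
    ∃ h' : ℝ → ℂ → ℂ, IsMotion P β v (m * t + ε) h' := by
  have ho : IsOpen (Metric.ball (0 : ℂ) 1) := Metric.isOpen_ball
  have h0 : (0 : ℂ) ∈ Metric.ball (0 : ℂ) 1 := Metric.mem_ball_self one_pos
  have hf0 := hfP 0 h0P
  have hp0 : p.eval (0 : ℂ) = 0 := by simpa [hv0] using hpv 0 h0P
  have hex : ∀ x ∈ P, x ≠ 0 → ∃ u : ℂ → ℂ,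
      DifferentiableOn ℂ u (Metric.ball 0 1) ∧ u 0 = (|x| : ℝ) ∧
      ((b * Real.exp (-1 / |x| ^ ℓ) * (ℓ * |x| ^ (-ℓ - 1)) : ℝ) : ℂ) * deriv u 0 =
        (t * (v (flatMap ℓ b c x) - v (flatMap ℓ b c 0)) : ℝ) ∧
      (∀ z ∈ Metric.ball (0 : ℂ) 1, u z ∈ Metric.ball ((β / 2 : ℝ) : ℂ) (β / 2)) ∧
      ∀ z ∈ Metric.ball (0 : ℂ) 1, h (flatMap ℓ b c x) z - h (flatMap ℓ b c 0) z =
        b * Complex.exp (-(u z) ^ (-ℓ : ℂ)) := by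
    intro x hx hx0
    have hfx := hfP x hx
    have hne : flatMap ℓ b c x ≠ flatMap ℓ b c 0 := by
      rw [flatMap_of_ne hx0, flatMap_zero]
      have : 0 < b * Real.exp (-1 / |x| ^ ℓ) := by positivity
      linarith
    obtain ⟨u, h1, h2, h3, h4, h5⟩ := exists_flat_lift hℓ hb hβ (abs_pos.2 hx0) hbβ
      (g := fun z => h (flatMap ℓ b c x) z - h (flatMap ℓ b c 0) z)
      ((H.differentiableOn _ hfx).sub (H.differentiableOn _ hf0))
      (fun z hz => sub_ne_zero.2 fun e => hne (H.injOn z hz hfx hf0 e))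
      (fun z hz => (norm_sub_le _ _).trans_lt (by
        linarith [H.norm_lt _ hfx z hz, H.norm_lt _ hf0 z hz]))
      (by
        simp only [H.base _ hfx, H.base _ hf0]
        rw [flatMap_of_ne hx0, flatMap_zero, ← Complex.ofReal_sub, add_sub_cancel_right])
    refine ⟨u, h1, h2, ?_, h4, h5⟩
    rw [h3, deriv_fun_sub ((H.differentiableOn _ hfx).differentiableAt (ho.mem_nhds h0))
      ((H.differentiableOn _ hf0).differentiableAt (ho.mem_nhds h0)), H.deriv_eq _ hfx,
      H.deriv_eq _ hf0]
    push_cast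
    ring
  choose! u hud hu0 hu' hub hug using hex
  let σ : ℝ → ℝ := fun x => SignType.sign x
  have hσ : ∀ x, x ≠ 0 → σ x = 1 ∨ σ x = -1 := by
    intro x hx
    rcases lt_or_gt_of_ne hx with hx | hx
    · right; simp [σ, hx]
    · left; simp [σ, hx]
  have hσC : ∀ x, x ≠ 0 → (σ x : ℂ) = 1 ∨ (σ x : ℂ) = -1 := fun x hx =>
    (hσ x hx).imp (fun e => by rw [e]; simp) (fun e => by rw [e]; simp)
  have hure : ∀ x ∈ P, x ≠ 0 → ∀ z ∈ Metric.ball (0 : ℂ) 1, 0 < (u x z).re := by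
    intro x hx hx0 z hz
    have h1 := hub x hx hx0 z hz
    rw [Metric.mem_ball, dist_eq_norm] at h1
    have h2 := (abs_le.1 (Complex.abs_re_le_norm (u x z - ((β / 2 : ℝ) : ℂ)))).1
    simp at h1 h2
    linarith
  let w : ℝ → ℂ → ℂ := fun x z => σ x * u x z
  have hw0 : ∀ z, w 0 z = 0 := fun z => by simp [w, σ]
  have hwd : ∀ x ∈ P, DifferentiableOn ℂ (w x) (Metric.ball 0 1) := by
    intro x hx
    by_cases hx0 : x = 0
    · subst hx0
      exact (differentiableOn_const (0 : ℂ)).congr fun z _ => hw0 z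
    · exact (hud x hx hx0).const_mul _
  have hwb : ∀ x ∈ P, w x 0 = x := by
    intro x hx
    by_cases hx0 : x = 0
    · subst hx0; simp [hw0]
    · simp only [w, hu0 x hx hx0]
      rw [← Complex.ofReal_mul, sign_mul_abs]
  have hw' : ∀ x ∈ P, deriv (w x) 0 = (m * t * v x : ℝ) := by
    intro x hx
    by_cases hx0 : x = 0
    · subst hx0
      rw [show w 0 = fun _ => 0 from funext hw0, deriv_const, hv0]
      simp
    · have e1 : deriv (w x) 0 = σ x * deriv (u x) 0 :=
        deriv_const_mul _ ((hud x hx hx0).differentiableAt (ho.mem_nhds h0))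
      have e2 := hu' x hx hx0
      rw [← hv x hx hx0] at e2
      set k := b * Real.exp (-1 / |x| ^ ℓ) * (ℓ * |x| ^ (-ℓ - 1)) with hk
      have hk0 : (k : ℂ) ≠ 0 := by
        have : 0 < |x| := abs_pos.2 hx0
        have : 0 < ℓ := by linarith
        have : 0 < k := by positivity
        exact_mod_cast this.ne'
      have e3 : flatDeriv ℓ b x = σ x * k := rfl
      rw [e3] at e2
      have e4 : (σ x : ℂ) ^ 2 = 1 := by rcases hσC x hx0 with e | e <;> rw [e] <;> norm_num
      rw [e1]
      apply mul_left_cancel₀ hk0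
      push_cast at e2 ⊢
      linear_combination (σ x : ℂ) * e2 + (m * k * t * v x : ℂ) * e4
  -- Since `Re u > 0`, the sign of `Re w` recovers that of `x`. Equal values of `u` then force equal
  -- images under the old motion, so `f x = f y` and `|x| = |y|`.
  have hwinj : ∀ z ∈ Metric.ball (0 : ℂ) 1, Set.InjOn (fun x => w x z) P := by
    intro z hz x hx y hy hxy
    simp only at hxy
    have hwre : ∀ x ∈ P, x ≠ 0 → σ x = SignType.sign (w x z).re := by
      intro x hx hx0
      have h1 : (w x z).re = σ x * (u x z).re := by simp [w]
      rw [h1]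
      have h2 := hure x hx hx0 z hz
      rcases hσ x hx0 with e | e
      · rw [e]; simp [h2]
      · rw [e]; simp [h2]
    have hwre0 : ∀ x ∈ P, x ≠ 0 → w x z ≠ 0 := by
      intro x hx hx0 e
      have h1 := hwre x hx hx0
      rw [e] at h1
      rcases hσ x hx0 with e | e <;> rw [e] at h1 <;> simp at h1
    by_cases hx0 : x = 0
    · by_contra hne
      exact hwre0 y hy (fun e => hne (hx0.trans e.symm)) (by rw [← hxy, hx0, hw0])
    by_cases hy0 : y = 0
    · exact absurd (by rw [hxy, hy0, hw0]) (hwre0 x hx hx0)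
    have hs : σ x = σ y := by rw [hwre x hx hx0, hwre y hy hy0, hxy]
    have huu : u x z = u y z := by
      have h1 : (σ x : ℂ) * u x z = σ y * u y z := hxy
      rw [← hs] at h1
      refine mul_left_cancel₀ ?_ h1
      rcases hσC x hx0 with e | e <;> rw [e] <;> norm_num
    have hff : flatMap ℓ b c x = flatMap ℓ b c y := by
      refine H.injOn z hz (hfP x hx) (hfP y hy) ?_
      have h1 := hug x hx hx0 z hz
      rw [huu, ← hug y hy hy0 z hz] at h1
      exact sub_left_injective h1
    rw [flatMap_of_ne hx0, flatMap_of_ne hy0, add_left_inj, mul_right_inj' hb.ne',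
      Real.exp_eq_exp, neg_div, neg_div, neg_inj, one_div, one_div, inv_inj,
      Real.rpow_left_inj (abs_nonneg _) (abs_nonneg _) (by linarith)] at hff
    rw [← sign_mul_abs x, ← sign_mul_abs y, hff]
    congr 1
  have hwball : ∀ x ∈ P, ∀ z ∈ Metric.ball (0 : ℂ) 1, ∀ s : ℂ, ‖s‖ < 2 * ε →
      ‖w x z + s * p.eval (w x z)‖ < β := by
    intro x hx z hz s hs
    by_cases hx0 : x = 0
    · rw [hx0, hw0, hp0]; simpa using hβ
    · exact (hinj s hs).2 _ (hσC x hx0) _ (hub x hx hx0 z hz)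
  have hsmall : ∀ z ∈ Metric.ball (0 : ℂ) 1, ‖(ε : ℂ) * z‖ < 2 * ε := by
    intro z hz
    rw [norm_mul, Complex.norm_real, Real.norm_of_nonneg hε.le]
    rw [mem_ball_zero_iff] at hz
    nlinarith
  -- The perturbation parameter `s = ε z` vanishes at the base point and contributes `ε p(x) = ε
  -- v(x)` to the velocity.
  refine ⟨fun x z => w x z + (ε * z) * p.eval (w x z), ?_, ?_, ?_, ?_, ?_, ?_⟩
  · intro x hx
    have h1 := hwd x hx
    have h2 : DifferentiableOn ℂ (fun z => p.eval (w x z)) (Metric.ball 0 1) :=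
      p.differentiable.comp_differentiableOn h1
    exact h1.add ((differentiableOn_id.const_mul _).mul h2)
  · intro x hx
    simp [hwb x hx]
  · intro x hx
    have h1 := ((hwd x hx).differentiableAt (ho.mem_nhds h0)).hasDerivAt
    have h2 : HasDerivAt (fun z => p.eval (w x z)) (p.derivative.eval (w x 0) * deriv (w x) 0) 0 :=
      (p.hasDerivAt (w x 0)).comp 0 h1
    have h3 := h1.add (((hasDerivAt_id (0 : ℂ)).const_mul (ε : ℂ)).mul h2)
    refine h3.deriv.trans ?_
    rw [hw' x hx, hwb x hx, hpv x hx]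
    push_cast
    simp
    ring
  · intro x hx z hz
    exact hwball x hx z hz _ (hsmall z hz)
  · intro z hz
    simp [hw0, hp0]
  · intro z hz
    refine (hinj _ (hsmall z hz)).1.comp (hwinj z hz) fun x hx => ?_
    have := hwball x hx z hz 0 (by simpa using hε)
    simpa using this

/-- Infinitesimal rigidity: the transfer operator has no real eigenvalue `≥ 1`. -/
theorem flat_rigidity {ℓ b β c : ℝ} (hℓ : 1 ≤ ℓ) (hb : 0 < b) (hβ : 0 < β)
    (hbβ : b * Real.exp (-1 / β ^ ℓ) = 2 * β) {P : Finset ℝ} (hP : ∀ x ∈ P, |x| < β) (h0P : 0 ∈ P)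
    (hfP : ∀ x ∈ P, flatMap ℓ b c x ∈ P) {v : ℝ → ℝ} (hv0 : v 0 = 0) {m : ℝ} (hm : 1 ≤ m)
    (hv : ∀ x ∈ P, x ≠ 0 → m * (flatDeriv ℓ b x * v x) =
      v (flatMap ℓ b c x) - v (flatMap ℓ b c 0)) : ∀ x ∈ P, v x = 0 := by
  obtain ⟨p, r, hpv, hpr⟩ := exists_interpolating_polynomial P hP v
  obtain ⟨ε, hε, hinj⟩ := exists_univalent_perturbation hβ hpr
  -- Since `m ≥ 1`, every lift increases `t` by at least `ε / 2`, eventually violating the Schwarz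
  -- bound wherever `v x ≠ 0`.
  have key : ∀ n : ℕ, ∃ t : ℝ, n * (ε / 2) ≤ t ∧ ∃ h, IsMotion P β v t h := by
    intro n
    induction n with
    | zero => exact ⟨0, by simp, _, isMotion_const hP v⟩
    | succ n ih =>
      obtain ⟨t, ht, h, H⟩ := ih
      refine ⟨m * t + ε / 2, ?_, H.lift hℓ hb hβ hbβ h0P hfP hv0 hv hpv
        (by rwa [mul_div_cancel₀ _ (two_ne_zero' ℝ)]) (half_pos hε)⟩
      have : 0 ≤ t := le_trans (by positivity) ht
      push_cast
      nlinarith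
  intro x hx
  by_contra hne
  have hpos : 0 < |v x| := abs_pos.2 hne
  obtain ⟨n, hn⟩ := exists_nat_gt (2 * β / (ε / 2 * |v x|))
  obtain ⟨t, ht, h, H⟩ := key n
  have h1 := H.abs_mul_le hx
  rw [div_lt_iff₀ (by positivity)] at hn
  have h2 : 0 ≤ t := le_trans (by positivity) ht
  rw [abs_mul, abs_of_nonneg h2] at h1
  nlinarith

/-! ### Real calculus of the family -/

theorem flatMap_eq_add (ℓ b c x : ℝ) : flatMap ℓ b c x = flatMap ℓ b 0 x + c := by
  unfold flatMap; split_ifs <;> simp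

theorem hasDerivAt_flatMap (ℓ b c : ℝ) {x : ℝ} (hx : x ≠ 0) :
    HasDerivAt (flatMap ℓ b c) (flatDeriv ℓ b x) x := by
  have hax : |x| ≠ 0 := abs_ne_zero.2 hx
  have h1 : HasDerivAt (fun y : ℝ => |y|) (SignType.sign x : ℝ) x := hasDerivAt_abs hx
  have h2 := ((h1.rpow_const (p := -ℓ) (Or.inl hax)).neg.exp.const_mul b).add_const c
  refine (h2.congr_deriv ?_).congr_of_eventuallyEq ?_
  · rw [flatDeriv, Pi.neg_apply, Real.rpow_neg (abs_nonneg x), neg_div, one_div]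
    ring
  · filter_upwards [isOpen_ne.mem_nhds hx] with y hy
    rw [flatMap_of_ne hy, Pi.neg_apply, Real.rpow_neg (abs_nonneg y), neg_div, one_div]

theorem flatDeriv_ne_zero {ℓ b x : ℝ} (hℓ : 0 < ℓ) (hb : 0 < b) (hx : x ≠ 0) :
    flatDeriv ℓ b x ≠ 0 := by
  have : 0 < |x| := abs_pos.2 hx
  have h1 : 0 < b * Real.exp (-1 / |x| ^ ℓ) * (ℓ * |x| ^ (-ℓ - 1)) := by positivity
  refine mul_ne_zero ?_ h1.ne'
  rcases lt_or_gt_of_ne hx with h | h <;> simp [h]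

theorem sign_flatDeriv {ℓ b : ℝ} (hℓ : 0 < ℓ) (hb : 0 < b) (x : ℝ) :
    SignType.sign (flatDeriv ℓ b x) = SignType.sign x := by
  by_cases hx : x = 0
  · simp [hx, flatDeriv]
  have : 0 < |x| := abs_pos.2 hx
  have h1 : 0 < b * Real.exp (-1 / |x| ^ ℓ) * (ℓ * |x| ^ (-ℓ - 1)) := by positivity
  rw [flatDeriv, sign_mul, sign_pos h1, mul_one]
  rcases lt_or_gt_of_ne hx with h | h <;> simp [h]

theorem flatMap_neg (ℓ b c x : ℝ) : flatMap ℓ b c (-x) = flatMap ℓ b c x := by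
  simp [flatMap]

theorem strictMonoOn_flatMap {ℓ b : ℝ} (hℓ : 0 < ℓ) (hb : 0 < b) (c : ℝ) :
    StrictMonoOn (flatMap ℓ b c) (Set.Ici 0) := by
  intro x hx y hy hxy
  have hx' : 0 ≤ x := hx
  have hy0 : 0 < y := lt_of_le_of_lt hx hxy
  rcases hx'.eq_or_lt with rfl | hx0
  · rw [flatMap_zero, flatMap_of_ne hy0.ne']
    have : 0 < b * Real.exp (-1 / |y| ^ ℓ) := by positivity
    linarith
  · rw [flatMap_of_ne hy0.ne', flatMap_of_ne hx0.ne', abs_of_pos hx0, abs_of_pos hy0, neg_div,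
      neg_div]
    have h1 : 0 < x ^ ℓ := Real.rpow_pos_of_pos hx0 _
    have h2 : x ^ ℓ < y ^ ℓ := Real.rpow_lt_rpow hx0.le hxy hℓ
    have h3 : 1 / y ^ ℓ < 1 / x ^ ℓ := one_div_lt_one_div_of_lt h1 h2
    gcongr

theorem continuous_flatMap {ℓ : ℝ} (hℓ : 0 < ℓ) (b c : ℝ) : Continuous (flatMap ℓ b c) := by
  rw [continuous_iff_continuousAt]
  intro x
  by_cases hx : x = 0
  · subst hx
    rw [continuousAt_iff_punctured_nhds, flatMap_zero]
    have h1 : Filter.Tendsto (fun x : ℝ => |x| ^ ℓ) (nhdsWithin 0 {0}ᶜ)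
        (nhdsWithin 0 (Set.Ioi 0)) := by
      rw [tendsto_nhdsWithin_iff]
      constructor
      · have h2 : Continuous fun x : ℝ => |x| ^ ℓ :=
          continuous_abs.rpow_const fun _ => Or.inr hℓ.le
        have h3 := h2.tendsto 0
        simp only [abs_zero, Real.zero_rpow hℓ.ne'] at h3
        exact h3.mono_left nhdsWithin_le_nhds
      · filter_upwards [self_mem_nhdsWithin] with x hx
        exact Real.rpow_pos_of_pos (abs_pos.2 hx) _
    have h4 := Real.tendsto_exp_neg_atTop_nhds_zero.comp (tendsto_inv_nhdsGT_zero.comp h1)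
    have h5 := (h4.const_mul b).add_const c
    rw [mul_zero, zero_add] at h5
    refine h5.congr' ?_
    filter_upwards [self_mem_nhdsWithin] with x hx
    rw [flatMap_of_ne hx, neg_div, one_div]
    rfl
  · exact (hasDerivAt_flatMap ℓ b c hx).continuousAt

theorem isUnimodal_flatMap {ℓ b : ℝ} (hℓ : 0 < ℓ) (hb : 0 < b) (c : ℝ) :
    IsUnimodal (flatMap ℓ b c) := by
  refine ⟨continuous_flatMap hℓ b c, fun x hx y hy hxy => ?_, strictMonoOn_flatMap hℓ hb c⟩
  rw [← flatMap_neg ℓ b c x, ← flatMap_neg ℓ b c y]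
  exact strictMonoOn_flatMap hℓ hb c (by simpa using hy) (by simpa using hx) (by linarith)

theorem le_flatMap_of_le_abs {ℓ b β c x : ℝ} (hℓ : 0 < ℓ) (hb : 0 < b) (hβ : 0 < β)
    (hfix : flatMap ℓ b (-β) β = β) (hc : -β ≤ c) (hx : β ≤ |x|) : β ≤ flatMap ℓ b c x := by
  have h1 : flatMap ℓ b c x = flatMap ℓ b c |x| := by
    rcases abs_choice x with h | h <;> rw [h]
    rw [flatMap_neg]
  have h2 := (strictMonoOn_flatMap hℓ hb c).monotoneOn (Set.mem_Ici.2 hβ.le)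
    (Set.mem_Ici.2 (abs_nonneg x)) hx
  rw [flatMap_eq_add] at hfix h2
  linarith

/-- The region `|x| ≥ β` is forward invariant when `c ≥ -β`, so an orbit entering it never returns
to `0`. -/
theorem abs_iterate_flatMap_lt {ℓ b β c : ℝ} (hℓ : 0 < ℓ) (hb : 0 < b) (hβ : 0 < β)
    (hfix : flatMap ℓ b (-β) β = β) (hc : -β ≤ c) {q : ℕ} (hq : 0 < q)
    (hper : Function.IsPeriodicPt (flatMap ℓ b c) q 0) (n : ℕ) :
    |(flatMap ℓ b c)^[n] 0| < β := by
  by_contra! hn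
  have h1 : ∀ k, β ≤ |(flatMap ℓ b c)^[n + k] 0| := by
    intro k
    induction k with
    | zero => exact hn
    | succ k ih =>
      rw [← add_assoc, Function.iterate_succ_apply']
      exact (le_flatMap_of_le_abs hℓ hb hβ hfix hc ih).trans (le_abs_self _)
  have h2 := h1 (n * q - n)
  rw [Nat.add_sub_cancel' (Nat.le_mul_of_pos_right n hq)] at h2
  rw [(hper.const_mul n).eq, abs_zero] at h2
  linarith

/-! ### Positive transversality -/

/-- The derivatives `D f^n (f 0)` of the iterates at the critical value. -/
noncomputable def criticalMultiplier (ℓ b c : ℝ) (n : ℕ) : ℝ :=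
  ∏ k ∈ Finset.range n, flatDeriv ℓ b ((flatMap ℓ b c)^[k + 1] 0)

/-- The solution of the recursion `v₀ = 0`, `v_{n+1} = 1 + m f'(f^n(0)) v_n`; for `m = 1` it is the
derivative of `f_c^n(0)` in the parameter. -/
noncomputable def criticalVariation (ℓ b c m : ℝ) : ℕ → ℝ
  | 0 => 0
  | n + 1 => 1 + m * (flatDeriv ℓ b ((flatMap ℓ b c)^[n] 0) * criticalVariation ℓ b c m n)

theorem criticalMultiplier_succ (ℓ b c : ℝ) (n : ℕ) : criticalMultiplier ℓ b c (n + 1) =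
    criticalMultiplier ℓ b c n * flatDeriv ℓ b ((flatMap ℓ b c)^[n + 1] 0) :=
  Finset.prod_range_succ _ _

theorem iterate_flatMap_ne_zero {ℓ b c : ℝ} {q : ℕ}
    (hq : Function.minimalPeriod (flatMap ℓ b c) 0 = q) {n : ℕ} (hn0 : 0 < n) (hn : n < q) :
    (flatMap ℓ b c)^[n] 0 ≠ 0 := fun h =>
  Function.not_isPeriodicPt_of_pos_of_lt_minimalPeriod hn0.ne' (hq ▸ hn) h

theorem criticalMultiplier_ne_zero {ℓ b c : ℝ} (hℓ : 0 < ℓ) (hb : 0 < b) {q : ℕ}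
    (hq : Function.minimalPeriod (flatMap ℓ b c) 0 = q) {n : ℕ} (hn : n < q) :
    criticalMultiplier ℓ b c n ≠ 0 := by
  refine Finset.prod_ne_zero_iff.2 fun k hk => flatDeriv_ne_zero hℓ hb ?_
  have := Finset.mem_range.1 hk
  exact iterate_flatMap_ne_zero hq (by omega) (by omega)

theorem criticalVariation_succ_eq {ℓ b c m : ℝ} (hℓ : 0 < ℓ) (hb : 0 < b) (hm : m ≠ 0) {q : ℕ}
    (hq : Function.minimalPeriod (flatMap ℓ b c) 0 = q) {n : ℕ} (hn : n < q) :
    criticalVariation ℓ b c m (n + 1) = m ^ n * criticalMultiplier ℓ b c n *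
      ∑ k ∈ Finset.range (n + 1), m⁻¹ ^ k * (1 / criticalMultiplier ℓ b c k) := by
  induction n with
  | zero => simp [criticalVariation, criticalMultiplier]
  | succ n ih =>
    have h0 := criticalMultiplier_ne_zero hℓ hb hq hn
    rw [criticalVariation, ih (by omega), Finset.sum_range_succ _ (n + 1), mul_add]
    have h1 : m ^ (n + 1) * criticalMultiplier ℓ b c (n + 1) *
        (m⁻¹ ^ (n + 1) * (1 / criticalMultiplier ℓ b c (n + 1))) = 1 := by
      rw [inv_pow]; field_simp
    rw [h1, criticalMultiplier_succ]
    ring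

/-- If the variation vanished at time `q`, it would close up to a function on the periodic orbit
satisfying the eigenvalue equation, with value `1` at the critical value; rigidity forbids this. -/
theorem criticalVariation_ne_zero {ℓ b β c m : ℝ} (hℓ : 1 ≤ ℓ) (hb : 0 < b) (hβ : 0 < β)
    (hfix : flatMap ℓ b (-β) β = β) (hc : -β ≤ c) {q : ℕ} (hq0 : 0 < q)
    (hq : Function.minimalPeriod (flatMap ℓ b c) 0 = q) (hm : 1 ≤ m) :
    criticalVariation ℓ b c m q ≠ 0 := by
  intro hzero
  have hℓ0 : 0 < ℓ := by linarith
  set f := flatMap ℓ b c with hf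
  set e := criticalVariation ℓ b c m with he
  have hper : Function.IsPeriodicPt f q 0 := hq ▸ Function.isPeriodicPt_minimalPeriod f 0
  have hinj : Set.InjOn (fun n => f^[n] 0) (Set.Iio q) := by
    rw [← hq]; exact Function.iterate_injOn_Iio_minimalPeriod
  have hbβ : b * Real.exp (-1 / β ^ ℓ) = 2 * β := by
    rw [flatMap_of_ne hβ.ne', abs_of_pos hβ] at hfix
    linarith
  let v : ℝ → ℝ := fun y => e (Function.invFunOn (fun n => f^[n] 0) (Set.Iio q) y)
  have hv : ∀ n < q, v (f^[n] 0) = e n := fun n hn =>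
    congrArg e (hinj.leftInvOn_invFunOn (Set.mem_Iio.2 hn))
  have hv0 : v 0 = 0 := hv 0 hq0
  have hvs : ∀ n < q, v (f^[n + 1] 0) = e (n + 1) := by
    intro n hn
    rcases Nat.lt_or_ge (n + 1) q with h | h
    · exact hv _ h
    · have : n + 1 = q := by omega
      rw [this, hper.eq, hv0, hzero]
  let P : Finset ℝ := (Finset.range q).image fun n => f^[n] 0
  have hmem : ∀ n < q, f^[n] 0 ∈ P := fun n hn =>
    Finset.mem_image_of_mem _ (Finset.mem_range.2 hn)
  have h0P : (0 : ℝ) ∈ P := hmem 0 hq0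
  have hforall : ∀ {p : ℝ → Prop}, (∀ n < q, p (f^[n] 0)) → ∀ x ∈ P, p x := by
    intro p hp x hx
    obtain ⟨n, hn, rfl⟩ := Finset.mem_image.1 hx
    exact hp n (Finset.mem_range.1 hn)
  have hfP : ∀ x ∈ P, f x ∈ P := by
    refine hforall fun n hn => ?_
    rw [← Function.iterate_succ_apply' f]
    rcases Nat.lt_or_ge (n + 1) q with h | h
    · exact hmem _ h
    · have : n.succ = q := by omega
      rw [this, hper.eq]
      exact h0P
  have hv1 : v (f 0) = 1 := by
    have := hvs 0 hq0
    rw [zero_add, Function.iterate_one] at this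
    rw [this]
    simp [he, criticalVariation]
  have hrigid := flat_rigidity hℓ hb hβ hbβ (P := P) (c := c)
    (hforall fun n _ => abs_iterate_flatMap_lt hℓ0 hb hβ hfix hc hq0 hper n) h0P hfP hv0 hm
    (hforall fun n hn _ => by
      rw [← hf, ← Function.iterate_succ_apply' f, hvs n hn, hv n hn, hv1, he, criticalVariation]
      ring) _ (hfP 0 h0P)
  rw [hv1] at hrigid
  exact one_ne_zero hrigid

/-- Otherwise the polynomial `D`, equal to `1` at `0`, has a root `ρ ∈ (0, 1]`, and the critical
variation with `m = ρ⁻¹ ≥ 1` vanishes at time `q`. -/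
theorem sum_inv_criticalMultiplier_pos {ℓ b β c : ℝ} (hℓ : 1 ≤ ℓ) (hb : 0 < b) (hβ : 0 < β)
    (hfix : flatMap ℓ b (-β) β = β) (hc : -β ≤ c) {q : ℕ} (hq0 : 0 < q)
    (hq : Function.minimalPeriod (flatMap ℓ b c) 0 = q) :
    0 < ∑ k ∈ Finset.range q, 1 / criticalMultiplier ℓ b c k := by
  by_contra! hle
  let D : ℝ → ℝ := fun ρ => ∑ k ∈ Finset.range q, ρ ^ k * (1 / criticalMultiplier ℓ b c k)
  have hD : Continuous D := by fun_prop
  have hD0 : D 0 = 1 := by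
    simp only [D]
    rw [Finset.sum_eq_single_of_mem 0 (Finset.mem_range.2 hq0)]
    · simp [criticalMultiplier]
    · intro k _ hk; simp [hk]
  have hD1 : D 1 ≤ 0 := by simpa [D] using hle
  obtain ⟨ρ, ⟨hρ0, hρ1⟩, hρ⟩ := intermediate_value_Icc' zero_le_one hD.continuousOn
    (⟨hD1, by rw [hD0]; exact zero_le_one⟩ : (0 : ℝ) ∈ Set.Icc (D 1) (D 0))
  have hρpos : 0 < ρ := hρ0.lt_of_ne (by rintro rfl; rw [hD0] at hρ; exact one_ne_zero hρ)
  refine criticalVariation_ne_zero hℓ hb hβ hfix hc hq0 hq ((one_le_inv₀ hρpos).2 hρ1) ?_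
  obtain ⟨n, rfl⟩ := Nat.exists_eq_add_one.2 hq0
  rw [criticalVariation_succ_eq (by linarith) hb (inv_pos.2 hρpos).ne' hq (Nat.lt_succ_self n),
    inv_inv]
  exact mul_eq_zero_of_right _ hρ

theorem hasDerivAt_iterate_parameter {ℓ b c : ℝ} {q : ℕ}
    (hq : Function.minimalPeriod (flatMap ℓ b c) 0 = q) {n : ℕ} (hn : n ≤ q) :
    HasDerivAt (fun t => (flatMap ℓ b t)^[n] 0) (criticalVariation ℓ b c 1 n) c := by
  induction n with
  | zero => exact hasDerivAt_const _ _
  | succ n ih =>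
    simp only [Function.iterate_succ_apply', criticalVariation, one_mul]
    have h1 : (fun t => flatMap ℓ b t ((flatMap ℓ b t)^[n] 0)) =
        fun t => flatMap ℓ b 0 ((flatMap ℓ b t)^[n] 0) + t :=
      funext fun t => flatMap_eq_add _ _ _ _
    rw [h1]
    -- The first step starts at the turning point, where `f_t(0) = t` is used directly; later points
    -- are nonzero, so the chain rule applies.
    rcases Nat.eq_zero_or_pos n with rfl | hn0
    · simpa [flatMap_zero, criticalVariation] using hasDerivAt_id' c
    · have h2 := (hasDerivAt_flatMap ℓ b 0 (iterate_flatMap_ne_zero hq hn0 hn)).comp c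
        (ih (by omega))
      exact (h2.add (hasDerivAt_id c)).congr_deriv (add_comm _ _)

theorem hasDerivAt_iterate_criticalValue {ℓ b c : ℝ} {q : ℕ}
    (hq : Function.minimalPeriod (flatMap ℓ b c) 0 = q) {n : ℕ} (hn : n < q) :
    HasDerivAt (flatMap ℓ b c)^[n] (criticalMultiplier ℓ b c n) c := by
  induction n with
  | zero => simpa [criticalMultiplier] using hasDerivAt_id c
  | succ n ih =>
    have h1 : (flatMap ℓ b c)^[n] c = (flatMap ℓ b c)^[n + 1] 0 := by
      rw [Function.iterate_succ_apply, flatMap_zero]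
    have h2 := hasDerivAt_flatMap ℓ b c (iterate_flatMap_ne_zero hq n.succ_pos hn)
    rw [Nat.succ_eq_add_one, ← h1] at h2
    rw [Function.iterate_succ']
    refine (h2.comp c (ih (by omega))).congr_deriv ?_
    rw [criticalMultiplier_succ, mul_comm, h1]

theorem positivelyTransversal_flatMap {ℓ b β c : ℝ} (hℓ : 1 ≤ ℓ) (hb : 0 < b) (hβ : 0 < β)
    (hfix : flatMap ℓ b (-β) β = β) (hc : -β ≤ c) {q : ℕ} (hq0 : 0 < q)
    (hq : Function.minimalPeriod (flatMap ℓ b c) 0 = q) :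
    PositivelyTransversal (flatMap ℓ b) c q := by
  have hℓ0 : 0 < ℓ := by linarith
  have hsum : ∑ n ∈ Finset.range q, 1 / deriv ((flatMap ℓ b c)^[n]) c =
      ∑ n ∈ Finset.range q, 1 / criticalMultiplier ℓ b c n :=
    Finset.sum_congr rfl fun n hn => by
      rw [(hasDerivAt_iterate_criticalValue hq (Finset.mem_range.1 hn)).deriv]
  refine ⟨(hasDerivAt_iterate_parameter hq le_rfl).differentiableAt, fun n hn => ?_, ?_, ?_⟩
  · have h := hasDerivAt_iterate_criticalValue hq hn
    exact ⟨h.differentiableAt, h.deriv ▸ criticalMultiplier_ne_zero hℓ0 hb hq hn⟩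
  · rw [hsum, (hasDerivAt_iterate_parameter hq le_rfl).deriv,
      (hasDerivAt_iterate_criticalValue hq (Nat.sub_lt hq0 one_pos)).deriv]
    obtain ⟨n, rfl⟩ := Nat.exists_eq_add_one.2 hq0
    rw [criticalVariation_succ_eq hℓ0 hb one_ne_zero hq (Nat.lt_succ_self n), Nat.add_sub_cancel]
    have := criticalMultiplier_ne_zero hℓ0 hb hq (Nat.lt_succ_self n)
    simp only [inv_one, one_pow, one_mul]
    field_simp
  · rw [hsum]
    exact sum_inv_criticalMultiplier_pos hℓ hb hβ hfix hc hq0 hq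

/-! ### The Chebyshev parameter -/

theorem flatMap_neg_self_eq_iff {ℓ b β : ℝ} (hβ : 0 < β) :
    flatMap ℓ b (-β) β = β ↔ b * Real.exp (-1 / β ^ ℓ) = 2 * β := by
  rw [flatMap_of_ne hβ.ne', abs_of_pos hβ]
  constructor <;> intro h <;> linarith

/-- The derivative is `(x ^ ℓ - ℓ) / x ^ (ℓ + 1)`. Taking logarithms in the Chebyshev equation
prescribes the value of this function, whence uniqueness of `β`. -/
theorem strictAntiOn_log_add_rpow_neg {ℓ : ℝ} (hℓ : 0 < ℓ) :
    StrictAntiOn (fun x : ℝ => Real.log x + x ^ (-ℓ)) (Set.Ioc 0 (ℓ ^ (1 / ℓ))) := by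
  have hd : ∀ x : ℝ, 0 < x →
      HasDerivAt (fun x : ℝ => Real.log x + x ^ (-ℓ)) (x⁻¹ + -ℓ * x ^ (-ℓ - 1)) x := fun x hx =>
    (Real.hasDerivAt_log hx.ne').add (Real.hasDerivAt_rpow_const (Or.inl hx.ne'))
  refine strictAntiOn_of_deriv_neg (convex_Ioc _ _)
    (fun x hx => (hd x hx.1).continuousAt.continuousWithinAt) fun x hx => ?_
  rw [interior_Ioc] at hx
  have hx0 := hx.1
  rw [(hd x hx0).deriv, show -ℓ - 1 = -(ℓ + 1) by ring, Real.rpow_neg hx0.le,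
    Real.rpow_add_one hx0.ne']
  have h1 : x ^ ℓ < ℓ := by
    have := Real.rpow_lt_rpow hx0.le hx.2 hℓ
    rwa [← Real.rpow_mul hℓ.le, one_div_mul_cancel hℓ.ne', Real.rpow_one] at this
  have h2 : 0 < x ^ ℓ := Real.rpow_pos_of_pos hx0 _
  have h3 : x⁻¹ + -ℓ * (x ^ ℓ * x)⁻¹ = (x ^ ℓ - ℓ) / (x ^ ℓ * x) := by field_simp; ring
  rw [h3]
  exact div_neg_of_neg_of_pos (by linarith) (by positivity)

theorem existsUnique_isChebyshevParameter {ℓ b : ℝ} (hℓ : 1 ≤ ℓ)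
    (hb : 2 * (Real.exp 1 * ℓ) ^ (1 / ℓ) < b) : ∃! β : ℝ, IsChebyshevParameter ℓ b β := by
  have hℓ0 : 0 < ℓ := by linarith
  have hb0 : 0 < b := lt_of_le_of_lt (by positivity) hb
  set m := ℓ ^ (1 / ℓ) with hm
  have hm1 : 1 ≤ m := Real.one_le_rpow hℓ (by positivity)
  have hmℓ : m ^ ℓ = ℓ := by
    rw [hm, ← Real.rpow_mul hℓ0.le, one_div_mul_cancel hℓ0.ne', Real.rpow_one]
  refine existsUnique_of_exists_of_unique ?_ ?_
  · let k : ℝ → ℝ := fun x => b * Real.exp (-1 / x ^ ℓ) - 2 * x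
    -- With `a ≤ 1` and `b a ≤ 1`, `exp (-1 / a ^ ℓ) ≤ exp (-1 / a) ≤ 2 a ^ 2` gives `k a ≤ 0`; the
    -- hypothesis on `b` is exactly `k m > 0`.
    set a := min (1 / b) 1 with ha
    have ha0 : 0 < a := by positivity
    have ham : a ≤ m := (min_le_right _ _).trans hm1
    have hk : ContinuousOn k (Set.Icc a m) := by
      intro x hx
      have hx0 : 0 < x := ha0.trans_le hx.1
      have h1 : x ^ ℓ ≠ 0 := (Real.rpow_pos_of_pos hx0 _).ne'
      have h2 : ContinuousAt (fun x : ℝ => x ^ ℓ) x :=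
        Real.continuousAt_rpow_const _ _ (Or.inl hx0.ne')
      exact (((continuousAt_const.div h2 h1).rexp.const_mul b).sub
        (continuousAt_id.const_mul 2)).continuousWithinAt
    have hka : k a ≤ 0 := by
      have h1 : a ^ ℓ ≤ a := by
        simpa using Real.rpow_le_rpow_of_exponent_ge ha0 (min_le_right _ _) hℓ
      have h2 : 0 < a ^ ℓ := Real.rpow_pos_of_pos ha0 _
      have h3 : 1 / a ≤ 1 / a ^ ℓ := one_div_le_one_div_of_le h2 h1
      have h4 := Real.quadratic_le_exp_of_nonneg (x := 1 / a) (by positivity)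
      have h5 : Real.exp (-1 / a ^ ℓ) ≤ 2 * a ^ 2 := by
        calc Real.exp (-1 / a ^ ℓ) ≤ Real.exp (-(1 / a)) := by
              rw [neg_div]; exact Real.exp_le_exp.2 (neg_le_neg h3)
          _ = (Real.exp (1 / a))⁻¹ := Real.exp_neg _
          _ ≤ ((1 / a) ^ 2 / 2)⁻¹ := by
              refine inv_anti₀ (by positivity) ?_
              have : 0 < 1 / a := by positivity
              linarith
          _ = 2 * a ^ 2 := by field_simp
      have h6 : b * a ≤ 1 := by
        have := min_le_left (1 / b) 1
        rw [← ha, le_div_iff₀ hb0] at this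
        linarith
      have h7 : b * Real.exp (-1 / a ^ ℓ) ≤ b * (2 * a ^ 2) := by gcongr
      simp only [k]
      nlinarith
    have hkm : 0 < k m := by
      simp only [k, hmℓ]
      rw [Real.mul_rpow (Real.exp_pos 1).le hℓ0.le, ← Real.exp_mul, one_mul, ← hm] at hb
      have h1 : Real.exp (1 / ℓ) * Real.exp (-1 / ℓ) = 1 := by
        rw [← Real.exp_add, neg_div, add_neg_cancel, Real.exp_zero]
      have h2 := mul_lt_mul_of_pos_right hb (Real.exp_pos (-1 / ℓ))
      have h3 : 2 * (Real.exp (1 / ℓ) * m) * Real.exp (-1 / ℓ) = 2 * m := by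
        linear_combination 2 * m * h1
      linarith
    obtain ⟨β, ⟨hβa, hβm⟩, hβ⟩ := intermediate_value_Icc ham hk ⟨hka, hkm.le⟩
    have hβ0 : 0 < β := ha0.trans_le hβa
    refine ⟨β, ⟨hβ0, hβm.lt_of_ne ?_⟩, (flatMap_neg_self_eq_iff hβ0).2 (sub_eq_zero.1 hβ)⟩
    rintro rfl
    exact hkm.ne' hβ
  · have hlog : ∀ β, IsChebyshevParameter ℓ b β →
        Real.log β + β ^ (-ℓ) = Real.log b - Real.log 2 := by
      rintro β ⟨⟨hβ0, _⟩, h⟩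
      have h1 := congrArg Real.log ((flatMap_neg_self_eq_iff hβ0).1 h)
      rw [Real.log_mul hb0.ne' (Real.exp_ne_zero _), Real.log_exp,
        Real.log_mul two_ne_zero hβ0.ne', neg_div, one_div] at h1
      rw [Real.rpow_neg hβ0.le]
      linarith
    intro β₁ β₂ h₁ h₂
    exact (strictAntiOn_log_add_rpow_neg hℓ0).injOn ⟨h₁.1.1, h₁.1.2.le⟩ ⟨h₂.1.1, h₂.1.2.le⟩
      ((hlog _ h₁).trans (hlog _ h₂).symm)

/-! ### Monotonicity of the kneading sequence -/

/-- A function on an interval that increases through each of its points is increasing. -/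
theorem le_of_eventually_monotone {α : Type*} [Preorder α] {φ : ℝ → α} {a b : ℝ} (hab : a ≤ b)
    (h : ∀ x ∈ Set.Icc a b, ∀ᶠ y in nhds x, (y ≤ x → φ y ≤ φ x) ∧ (x ≤ y → φ x ≤ φ y)) :
    φ a ≤ φ b := by
  let T : Set ℝ := {x | x ∈ Set.Icc a b ∧ φ a ≤ φ x}
  have haT : a ∈ T := ⟨⟨le_rfl, hab⟩, le_rfl⟩
  have hbdd : BddAbove T := ⟨b, fun x hx => hx.1.2⟩
  set s := sSup T with hs
  have has : a ≤ s := le_csSup hbdd haT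
  have hsb : s ≤ b := csSup_le ⟨a, haT⟩ fun x hx => hx.1.2
  obtain ⟨δ, hδ, hball⟩ := Metric.eventually_nhds_iff.1 (h s ⟨has, hsb⟩)
  have hsT : φ a ≤ φ s := by
    obtain ⟨x, hx, hlt⟩ := exists_lt_of_lt_csSup ⟨a, haT⟩ (sub_lt_self s hδ)
    have hxs : x ≤ s := le_csSup hbdd hx
    refine hx.2.trans ((hball ?_).1 hxs)
    rw [Real.dist_eq, abs_sub_lt_iff]
    constructor <;> linarith
  rcases hsb.eq_or_lt with hsb | hsb
  · rwa [hsb] at hsT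
  · obtain ⟨y, hy1, hy2⟩ := exists_between (lt_min hsb (lt_add_of_pos_right s hδ))
    have hyT : y ∈ T := by
      refine ⟨⟨has.trans hy1.le, hy2.le.trans (min_le_left _ _)⟩, hsT.trans ((hball ?_).2 hy1.le)⟩
      rw [Real.dist_eq, abs_sub_lt_iff]
      constructor <;> linarith [min_le_right b (s + δ)]
    exact absurd (le_csSup hbdd hyT) (not_le.2 hy1)

/-- The product of the first `n` terms of the kneading sequence. -/
noncomputable def kneadingProd (f : ℝ → ℝ) (n : ℕ) : SignType :=
  ∏ k ∈ Finset.range n, SignType.sign (f^[k + 1] 0)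

theorem kneadingProd_succ (f : ℝ → ℝ) (n : ℕ) :
    kneadingProd f (n + 1) = kneadingProd f n * SignType.sign (f^[n + 1] 0) :=
  Finset.prod_range_succ _ _

theorem prod_kneadingSeq (f : ℝ → ℝ) (n : ℕ+) :
    ∏ k ∈ Finset.Icc 1 n, kneadingSeq f k = kneadingProd f n := by
  refine Finset.prod_nbij' PNat.natPred Nat.succPNat (fun k hk => ?_) (fun k hk => ?_)
    (fun k _ => PNat.succPNat_natPred k) (fun k _ => Nat.natPred_succPNat k) (fun k _ => ?_)
  · have h1 : (k : ℕ) ≤ n := (Finset.mem_Icc.1 hk).2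
    have h2 := PNat.natPred_add_one k
    exact Finset.mem_range.2 (by omega)
  · exact Finset.mem_Icc.2 ⟨one_le, Nat.succ_le_of_lt (Finset.mem_range.1 hk)⟩
  · rw [PNat.natPred_add_one, kneadingSeq]

/-- The first `N` partial products of the kneading sequence, lexicographically ordered. -/
noncomputable def kneadingWord (f : ℝ → ℝ) (N : ℕ) : Lex (Fin N → SignType) :=
  toLex fun k => kneadingProd f (k + 1)

theorem kneadingWord_lt {f g : ℝ → ℝ} {N n : ℕ} (hn : n < N)
    (heq : ∀ k < n, kneadingProd f (k + 1) = kneadingProd g (k + 1))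
    (hlt : kneadingProd f (n + 1) < kneadingProd g (n + 1)) :
    kneadingWord f N < kneadingWord g N :=
  ⟨⟨n, hn⟩, fun k hk => heq k hk, hlt⟩

theorem sign_criticalMultiplier {ℓ b : ℝ} (hℓ : 0 < ℓ) (hb : 0 < b) (c : ℝ) (n : ℕ) :
    SignType.sign (criticalMultiplier ℓ b c n) = kneadingProd (flatMap ℓ b c) n := by
  induction n with
  | zero => simp [criticalMultiplier, kneadingProd]
  | succ n ih => rw [criticalMultiplier_succ, kneadingProd_succ, sign_mul, ih, sign_flatDeriv hℓ hb]

theorem continuous_iterate_parameter {ℓ : ℝ} (hℓ : 0 < ℓ) (b : ℝ) (n : ℕ) :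
    Continuous fun t => (flatMap ℓ b t)^[n] 0 := by
  induction n with
  | zero => exact continuous_const
  | succ n ih =>
    simp only [Function.iterate_succ_apply']
    have h1 : (fun t => flatMap ℓ b t ((flatMap ℓ b t)^[n] 0)) =
        fun t => flatMap ℓ b 0 ((flatMap ℓ b t)^[n] 0) + t :=
      funext fun t => flatMap_eq_add _ _ _ _
    rw [h1]
    exact ((continuous_flatMap hℓ b 0).comp ih).add continuous_id

theorem eventually_kneadingProd_eq {ℓ b c : ℝ} (hℓ : 0 < ℓ) {n : ℕ}
    (hn : ∀ k < n, (flatMap ℓ b c)^[k + 1] 0 ≠ 0) :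
    ∀ᶠ y in nhds c, ∀ k ≤ n, kneadingProd (flatMap ℓ b y) k = kneadingProd (flatMap ℓ b c) k := by
  have h1 : ∀ᶠ y in nhds c, ∀ k ∈ Finset.range n,
      SignType.sign ((flatMap ℓ b y)^[k + 1] 0) = SignType.sign ((flatMap ℓ b c)^[k + 1] 0) := by
    rw [Filter.eventually_all_finset]
    intro k hk
    have h2 := (continuous_iterate_parameter hℓ b (k + 1)).tendsto c
    rcases lt_or_gt_of_ne (hn k (Finset.mem_range.1 hk)) with h | h
    · filter_upwards [h2.eventually_lt_const h] with y hy
      rw [sign_neg hy, sign_neg h]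
    · filter_upwards [h2.eventually_const_lt h] with y hy
      rw [sign_pos hy, sign_pos h]
  filter_upwards [h1] with y hy k hk
  refine Finset.prod_congr rfl fun j hj => hy j ?_
  exact Finset.mem_range.2 ((Finset.mem_range.1 hj).trans_le hk)

theorem eventually_kneadingWord_le {ℓ b β c : ℝ} (hℓ : 1 ≤ ℓ) (hb : 0 < b) (hβ : 0 < β)
    (hfix : flatMap ℓ b (-β) β = β) (hc : -β ≤ c) (N : ℕ) :
    ∀ᶠ y in nhds c,
      (y ≤ c → kneadingWord (flatMap ℓ b y) N ≤ kneadingWord (flatMap ℓ b c) N) ∧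
      (c ≤ y → kneadingWord (flatMap ℓ b c) N ≤ kneadingWord (flatMap ℓ b y) N) := by
  have hℓ0 : 0 < ℓ := by linarith
  by_cases hz : ∃ n, n < N ∧ (flatMap ℓ b c)^[n + 1] 0 = 0
  · classical
    obtain ⟨hnN, hn⟩ := Nat.find_spec hz
    set n := Nat.find hz
    have hmin : ∀ k < n, (flatMap ℓ b c)^[k + 1] 0 ≠ 0 := fun k hk h =>
      Nat.find_min hz hk ⟨hk.trans hnN, h⟩
    have hq : Function.minimalPeriod (flatMap ℓ b c) 0 = n + 1 := by
      have hper : Function.IsPeriodicPt (flatMap ℓ b c) (n + 1) 0 := hn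
      refine le_antisymm (hper.minimalPeriod_le n.succ_pos) ?_
      by_contra! hlt
      have hpos := hper.minimalPeriod_pos n.succ_pos
      refine hmin (Function.minimalPeriod (flatMap ℓ b c) 0 - 1) (by omega) ?_
      rw [Nat.sub_add_cancel hpos]
      exact Function.isPeriodicPt_minimalPeriod _ _
    have hS := sum_inv_criticalMultiplier_pos hℓ hb hβ hfix hc n.succ_pos hq
    have hM := criticalMultiplier_ne_zero hℓ0 hb hq n.lt_succ_self
    have hd := (hasDerivAt_iterate_parameter hq le_rfl).const_mul (criticalMultiplier ℓ b c n)
    -- The derivative equals the square of the multiplier times the positive sum. The sign of the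
    -- multiplier is the product of the earlier signs, so near `c` the next partial product is `sign
    -- (t - c)`.
    have hdpos : 0 < deriv (fun t => criticalMultiplier ℓ b c n * (flatMap ℓ b t)^[n + 1] 0) c := by
      rw [hd.deriv, criticalVariation_succ_eq hℓ0 hb one_ne_zero hq n.lt_succ_self]
      simp only [inv_one, one_pow, one_mul]
      rw [← mul_assoc]
      exact mul_pos (mul_self_pos.2 hM) hS
    have hsign := eventually_nhdsWithin_sign_eq_of_deriv_pos hdpos (by simp [hn])
    filter_upwards [hsign, eventually_kneadingProd_eq hℓ0 hmin] with y hy hyeq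
    have hprod : kneadingProd (flatMap ℓ b y) (n + 1) = SignType.sign (y - c) := by
      rw [← hy, kneadingProd_succ, hyeq n le_rfl, sign_mul, sign_criticalMultiplier hℓ0 hb]
    have hprod0 : kneadingProd (flatMap ℓ b c) (n + 1) = 0 := by
      rw [kneadingProd_succ, hn, sign_zero, mul_zero]
    constructor
    · intro hyc
      rcases hyc.eq_or_lt with rfl | hyc
      · exact le_rfl
      · refine (kneadingWord_lt hnN (fun k hk => hyeq _ hk) ?_).le
        rw [hprod, hprod0, sign_neg (sub_neg.2 hyc)]
        decide
    · intro hyc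
      rcases hyc.eq_or_lt with rfl | hyc
      · exact le_rfl
      · refine (kneadingWord_lt hnN (fun k hk => (hyeq _ hk).symm) ?_).le
        rw [hprod, hprod0, sign_pos (sub_pos.2 hyc)]
        decide
  · push Not at hz
    filter_upwards [eventually_kneadingProd_eq hℓ0 hz] with y hy
    have : kneadingWord (flatMap ℓ b y) N = kneadingWord (flatMap ℓ b c) N :=
      congrArg toLex (funext fun k => hy _ k.2)
    exact ⟨fun _ => this.le, fun _ => this.ge⟩

/-- At the first index where the signs differ, the preceding product is nonzero: an earlier zero
would make both sequences repeat an initial block on which they agree. Signs and partial products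
therefore first differ together. -/
theorem kneadingLE_of_kneadingWord_le {f g : ℝ → ℝ}
    (h : ∀ N, kneadingWord f N ≤ kneadingWord g N) :
    KneadingLE (kneadingSeq f) (kneadingSeq g) := by
  by_cases hne : ∃ n, SignType.sign (f^[n + 1] 0) ≠ SignType.sign (g^[n + 1] 0)
  · left
    classical
    have hn := Nat.find_spec hne
    have hmin : ∀ k < Nat.find hne, SignType.sign (f^[k + 1] 0) = SignType.sign (g^[k + 1] 0) :=
      fun k hk => not_not.1 (Nat.find_min hne hk)
    set n := Nat.find hne
    have hprod : ∀ k ≤ n, kneadingProd f k = kneadingProd g k := fun k hk =>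
      Finset.prod_congr rfl fun j hj => hmin j ((Finset.mem_range.1 hj).trans_le hk)
    have hn0 : kneadingProd f n ≠ 0 := by
      intro h0
      obtain ⟨p, hp, hfp⟩ := Finset.prod_eq_zero_iff.1 h0
      have hpn := Finset.mem_range.1 hp
      have hgp := hmin p hpn
      rw [hfp] at hgp
      have hiter : ∀ u : ℝ → ℝ, u^[p + 1] 0 = 0 → u^[n + 1] 0 = u^[n - (p + 1) + 1] 0 := by
        intro u hu
        rw [show n + 1 = (n - (p + 1) + 1) + (p + 1) by omega, Function.iterate_add_apply, hu]
      rw [hiter f (sign_eq_zero_iff.1 hfp), hiter g (sign_eq_zero_iff.1 hgp.symm)] at hn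
      exact hn (hmin _ (by omega))
    refine ⟨n.succPNat, fun k hk => ?_, ?_⟩
    · have h1 : (k : ℕ) < n + 1 := hk
      have h2 := hmin (k - 1) (by have := k.pos; omega)
      rwa [Nat.sub_add_cancel k.pos] at h2
    · rw [prod_kneadingSeq, prod_kneadingSeq, Nat.succPNat_coe]
      refine lt_of_not_ge fun hge => ?_
      rcases hge.eq_or_lt with heq | hlt
      · rw [Nat.succ_eq_add_one, kneadingProd_succ, kneadingProd_succ, ← hprod n le_rfl] at heq
        exact hn (mul_left_cancel₀ hn0 heq).symm
      · exact (h (n + 1)).not_gt (kneadingWord_lt n.lt_succ_self (fun k hk => (hprod _ hk).symm) hlt)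
  · right
    push Not at hne
    funext k
    have := hne (k - 1)
    rwa [Nat.sub_add_cancel k.pos] at this

theorem theorem1p1 (ℓ b : ℝ) (hℓ : 1 ≤ ℓ) (hb : 2 * (Real.exp 1 * ℓ) ^ (1 / ℓ) < b) :
    (∀ c : ℝ, IsUnimodal (flatMap ℓ b c)) ∧
    (∃! β : ℝ, IsChebyshevParameter ℓ b β) ∧
    ∀ β : ℝ, IsChebyshevParameter ℓ b β →
      (∀ c₁ c₂ : ℝ, -β ≤ c₁ → c₁ ≤ c₂ →
        KneadingLE (kneadingSeq (flatMap ℓ b c₁)) (kneadingSeq (flatMap ℓ b c₂))) ∧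
      (∀ c : ℝ, -β ≤ c → ∀ q : ℕ, 0 < q → Function.minimalPeriod (flatMap ℓ b c) 0 = q →
        PositivelyTransversal (flatMap ℓ b) c q) := by
  have hℓ0 : 0 < ℓ := by linarith
  have hb0 : 0 < b := lt_of_le_of_lt (by positivity) hb
  refine ⟨isUnimodal_flatMap hℓ0 hb0, existsUnique_isChebyshevParameter hℓ hb, fun β hβ => ⟨?_, ?_⟩⟩
  · intro c₁ c₂ h₁ h₁₂
    exact kneadingLE_of_kneadingWord_le fun N =>
      le_of_eventually_monotone (φ := fun c => kneadingWord (flatMap ℓ b c) N) h₁₂ fun c hc =>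
        eventually_kneadingWord_le hℓ hb0 hβ.1.1 hβ.2 (h₁.trans hc.1) N
  · intro c hc q hq0 hq
    exact positivelyTransversal_flatMap hℓ hb0 hβ.1.1 hβ.2 hc hq0 hq
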